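/- Let $n\ge 5$, let $\mathcal S^n$ be the space of real symmetric $n\times n$ matrices, and let $I_1=(1,2,\dots,n-2)$, $I_2=(2,3,\dots,n-1)$, …, $I_n=(n,1,\dots,n-3)$ be the cyclic shifts of $(1,\dots,n-2)$ modulo $n$; write $A_{I_j}$ for the principal submatrix of $A$ with rows and columns in $I_j$. A matrix $A\in\mathcal S^n$ is copositive if $x^TAx\ge 0$ for all $x\in\mathbb R^n_+$, and a copositive matrix is exceptional if it is not the sum of a positive semi-definite matrix and an element-wise nonnegative symmetric matrix. A zero of a copositive matrix $A$ is a nonzero $u\in\mathbb R^n_+$ with $u^TAu=0$; its support is the set of indices of its positive entries. An exceptional copositive matrix $A$ has minimal circulant zero support set if it has zeros $u^1,\dots,u^n$ with $\operatorname{supp}u^j=I_j$ for $j=1,\dots,n$ and every zero of $A$ is proportional to one of $u^1,\dots,u^n$. Let $\hat A\in\mathcal S^n$ be an exceptional copositive matrix with minimal circulant zero support set. Then there exists an open neighbourhood $\mathcal U\subset\mathcal S^n$ of $\hat A$ with the following properties: (i) if $A\in\mathcal U$ and $\det A_{I_j}=0$ for all $j=1,\dots,n$, then $A$ is an exceptional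 copositive matrix with minimal circulant zero support set; (ii) the set of matrices $A\in\mathcal U$ with $\det A_{I_j}=0$ for all $j=1,\dots,n$ is an algebraic submanifold of codimension $n$ in $\mathcal S^n$, that is, an embedded smooth submanifold of codimension $n$ which is a relatively open part of a real algebraic set and which near each of its points is the common zero set of $n$ polynomials with linearly independent differentials at that point. -/

import Mathlib

open scoped Matrix Topology

/-- The space `S^n` of real symmetric `n × n` matrices. -/
def symMat (n : ℕ) : Submodule ℝ (Matrix (Fin n) (Fin n) ℝ) where
  carrier := {A | A.IsSymm}
  add_mem' := fun hA hB => Matrix.IsSymm.add hA hB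
  zero_mem' := Matrix.isSymm_zero
  smul_mem' := fun c _ hA => Matrix.IsSymm.smul hA c

/- Smoothness on `S^n` needs a norm; the space is finite dimensional, so the choice (here the
maximum of the absolute values of the entries) is immaterial. -/
attribute [local instance] Matrix.normedAddCommGroup Matrix.normedSpace

section Copositive

variable {n : ℕ}

/-- `A` is symmetric and `xᵀ A x ≥ 0` for all `x ≥ 0`. -/
def IsCopositive (A : Matrix (Fin n) (Fin n) ℝ) : Prop :=
  A.IsSymm ∧ ∀ x : Fin n → ℝ, (∀ i, 0 ≤ x i) → 0 ≤ x ⬝ᵥ (A *ᵥ x)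

/-- A copositive matrix that is not the sum of a positive semi-definite matrix and an
element-wise nonnegative symmetric matrix. -/
def IsExceptional (A : Matrix (Fin n) (Fin n) ℝ) : Prop :=
  IsCopositive A ∧
    ¬ ∃ P N : Matrix (Fin n) (Fin n) ℝ,
        P.PosSemidef ∧ (N.IsSymm ∧ ∀ i j, 0 ≤ N i j) ∧ A = P + N

/-- `u` is a zero of `A`: a nonzero nonnegative vector with `uᵀ A u = 0`. -/
def IsZeroOf (A : Matrix (Fin n) (Fin n) ℝ) (u : Fin n → ℝ) : Prop :=
  u ≠ 0 ∧ (∀ i, 0 ≤ u i) ∧ u ⬝ᵥ (A *ᵥ u) = 0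

/-- The support of a nonnegative vector: the indices of its positive entries. -/
def vecSupp (u : Fin n → ℝ) : Set (Fin n) := {i | 0 < u i}

/-- The ordered index set `(j, j+1, …, j+n-3)`, indices taken modulo `n`. (Indices start
at `0`, so `circIndex j` lists the elements of `I_{j+1}`, shifted by one.) -/
def circIndex (j : Fin n) (i : Fin (n - 2)) : Fin n :=
  j + Fin.castLE (Nat.sub_le n 2) i

/-- The principal submatrix `A_{I_j}`. -/
def circSub (A : Matrix (Fin n) (Fin n) ℝ) (j : Fin n) :
    Matrix (Fin (n - 2)) (Fin (n - 2)) ℝ :=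
  A.submatrix (circIndex j) (circIndex j)

/-- `A` is an exceptional copositive matrix which possesses zeros `u^1, …, u^n` with supports
`I_1, …, I_n`, and every zero of `A` is proportional to one of them. -/
def HasMinimalCirculantZeroSupport (A : Matrix (Fin n) (Fin n) ℝ) : Prop :=
  IsExceptional A ∧
    ∃ u : Fin n → (Fin n → ℝ),
      (∀ j, IsZeroOf A (u j) ∧ vecSupp (u j) = Set.range (circIndex j)) ∧
      ∀ v, IsZeroOf A v → ∃ (j : Fin n) (c : ℝ), v = c • u j

end Copositive

section Submanifold

variable {E : Type*} [NormedAddCommGroup E] [NormedSpace ℝ E]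

/-- `f` is a polynomial in finitely many linear functionals on `E`. -/
def IsPolynomialFunction (f : E → ℝ) : Prop :=
  ∃ P : MvPolynomial (E →L[ℝ] ℝ) ℝ, ∀ x, f x = MvPolynomial.eval (fun l => l x) P

/-- `M` is an embedded smooth submanifold of codimension `k` of the finite dimensional space `E`:
near each of its points a smooth diffeomorphism between open sets of `E` straightens `M` to a
linear subspace of codimension `k`. -/
def IsSmoothSubmanifold (k : ℕ) (M : Set E) : Prop :=
  ∀ p ∈ M, ∃ (φ : OpenPartialHomeomorph E E) (W : Submodule ℝ E),
    p ∈ φ.source ∧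
    ContDiffOn ℝ ((⊤ : ℕ∞) : WithTop ℕ∞) φ φ.source ∧
    ContDiffOn ℝ ((⊤ : ℕ∞) : WithTop ℕ∞) φ.symm φ.target ∧
    Module.finrank ℝ W + k = Module.finrank ℝ E ∧
    ∀ x ∈ φ.source, x ∈ M ↔ φ x ∈ W

/-- `M` is a (nonsingular) algebraic submanifold of codimension `k` of the finite dimensional
space `E`: a smooth submanifold of codimension `k` that is a relatively open part of the common
zero set of finitely many polynomials, and that near each of its points is the common zero set
of `k` polynomials whose differentials at that point are linearly independent. -/
structure IsAlgebraicSubmanifold (k : ℕ) (M : Set E) : Prop where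
  smooth : IsSmoothSubmanifold k M
  algebraic : ∃ (V : Set E) (m : ℕ) (f : Fin m → E → ℝ), IsOpen V ∧
    (∀ i, IsPolynomialFunction (f i)) ∧ M = {x | x ∈ V ∧ ∀ i, f i x = 0}
  regular : ∀ p ∈ M, ∃ (V : Set E) (f : Fin k → E → ℝ), IsOpen V ∧ p ∈ V ∧
    (∀ i, IsPolynomialFunction (f i)) ∧
    (∀ x ∈ V, x ∈ M ↔ ∀ i, f i x = 0) ∧
    LinearIndependent ℝ (fun i => fderiv ℝ (f i) p)

end Submanifold

/-! Strict complementarity drives both parts. At a zero `u j` of `A`, the vector `A *ᵥ u j` vanishes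
on `I_j`, and it is positive off `I_j` (`IsCircZeroSystem.mulVec_pos`): otherwise some `u j + u k`
would be a zero whose support is too large. Small perturbations of `u j` inside its support show
that `A_{I_j}` is positive semidefinite with kernel spanned by the restriction of `u j`
(`IsCircZeroSystem.isCorankOne`).

For (i), definiteness modulo `u j` is an open condition, so a nearby matrix whose `j`-th determinant
vanishes still has corank one there, and the adjugate supplies a positive kernel vector. Near an old
zero the quadratic form splits into its part on `I_j` and a nonnegative remainder; compactness of
the simplex makes this global (`IsCircZeroSystem.eventually`). Exceptionality follows from the zero
pattern alone (`IsCircZeroSystem.isExceptional`).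

For (ii), the derivative of `det A_{I_j}` along `H` is a positive multiple of `u j ⬝ᵥ (H *ᵥ u j)`
(`IsCorankOne.hasDerivAt_det`). Strict complementarity gives directions dual to these functionals
(`IsCircZeroSystem.exists_direction`), so the differentials are independent and the inverse function
theorem applies. -/

/-! ### Cyclic index sets. -/

section Combinatorics

variable {n : ℕ}

/-- Replaces modular arithmetic by linear inequalities, so that `omega` can decide the combinatorial
facts. -/
lemma mem_range_circIndex (hn : 5 ≤ n) (j i : Fin n) :
    i ∈ Set.range (circIndex j) ↔
      (j.val ≤ i.val ∧ i.val < j.val + (n - 2)) ∨ (i.val + n < j.val + (n - 2)) := by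
  have hj := j.isLt
  have hi := i.isLt
  constructor
  · rintro ⟨k, rfl⟩
    have hk := k.isLt
    simp only [circIndex, Fin.val_add, Fin.val_castLE]
    rcases lt_or_ge (j.val + k.val) n with h | h
    · rw [Nat.mod_eq_of_lt h]; omega
    · rw [Nat.mod_eq_sub_mod h, Nat.mod_eq_of_lt (by omega)]; omega
  · rintro (h | h)
    · refine ⟨⟨i.val - j.val, by omega⟩, Fin.ext ?_⟩
      simp only [circIndex, Fin.val_add, Fin.val_castLE]
      rw [show j.val + (i.val - j.val) = i.val by omega, Nat.mod_eq_of_lt hi]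
    · refine ⟨⟨i.val + n - j.val, by omega⟩, Fin.ext ?_⟩
      simp only [circIndex, Fin.val_add, Fin.val_castLE]
      rw [show j.val + (i.val + n - j.val) = i.val + n by omega, Nat.add_mod_right,
        Nat.mod_eq_of_lt hi]

lemma circIndex_injective (hn : 5 ≤ n) (j : Fin n) : Function.Injective (circIndex j) := by
  intro a b h
  have : NeZero n := ⟨by omega⟩
  exact Fin.castLE_injective _ (add_left_cancel h)

lemma circIndex_range_inj (hn : 5 ≤ n) {j k : Fin n}
    (h : Set.range (circIndex j) = Set.range (circIndex k)) : j = k := by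
  have hj := j.isLt
  have hk := k.isLt
  have key : ∀ i : Fin n, i ∈ Set.range (circIndex j) ↔ i ∈ Set.range (circIndex k) := by
    intro i; rw [h]
  simp only [mem_range_circIndex hn] at key
  have h1 := key j
  have h2 := key k
  by_contra hne
  have hne' : j.val ≠ k.val := fun e => hne (Fin.ext e)
  rcases lt_or_gt_of_ne hne' with hlt | hlt
  · have h3 := key ⟨k.val - 1, by omega⟩
    simp only at h3
    omega
  · have h3 := key ⟨j.val - 1, by omega⟩
    simp only at h3
    omega

/-- An index outside `I_j` is added by a set `I_k` that is otherwise contained in `I_j`. -/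
lemma exists_circIndex_adjacent (hn : 5 ≤ n) {i j : Fin n}
    (hi : i ∉ Set.range (circIndex j)) :
    ∃ k, i ∈ Set.range (circIndex k) ∧
      ∀ l ∈ Set.range (circIndex k), l ≠ i → l ∈ Set.range (circIndex j) := by
  have hj := j.isLt
  have hil := i.isLt
  simp only [mem_range_circIndex hn] at hi ⊢
  have hne : ∀ l : Fin n, l ≠ i → l.val ≠ i.val := fun l h e => h (Fin.ext e)
  -- Modulo `n` the complement of `I_j` is `{j-1, j-2}`; `k = j-1` serves the first index and `k =
  -- j+1` the second.
  by_cases c : i.val + 1 = j.val ∨ (j.val = 0 ∧ i.val = n - 1)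
  · refine ⟨i, by omega, fun l hl hli => ?_⟩
    have := hne l hli
    have := l.isLt
    omega
  · by_cases hjn : j.val + 1 = n
    · refine ⟨⟨0, by omega⟩, ?_, fun l hl hli => ?_⟩
      · simp only; omega
      · have := hne l hli
        have := l.isLt
        simp only at hl
        omega
    · refine ⟨⟨j.val + 1, by omega⟩, ?_, fun l hl hli => ?_⟩
      · simp only; omega
      · have := hne l hli
        have := l.isLt
        simp only at hl
        omega

/-- Each index is missed by exactly two of the sets, so two indices rule out at most four of the
five sets tested. -/
lemma exists_circIndex_pair (hn : 5 ≤ n) (i k : Fin n) :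
    ∃ j, i ∈ Set.range (circIndex j) ∧ k ∈ Set.range (circIndex j) := by
  have hi := i.isLt
  have hk := k.isLt
  simp only [mem_range_circIndex hn]
  by_contra! h
  have h0 := h ⟨0, by omega⟩
  have h1 := h ⟨1, by omega⟩
  have h2 := h ⟨2, by omega⟩
  have h3 := h ⟨3, by omega⟩
  have h4 := h ⟨4, by omega⟩
  simp only at h0 h1 h2 h3 h4
  omega

/-- Take `a = j-1` and `b = j` modulo `n`: besides `I_j`, only `I_{j+1}` misses `a`, and it also
misses `b`. -/
lemma exists_circIndex_separating (hn : 5 ≤ n) (j : Fin n) :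
    ∃ a b : Fin n, a ∉ Set.range (circIndex j) ∧ b ∈ Set.range (circIndex j) ∧
      ∀ k, k ≠ j → a ∈ Set.range (circIndex k) ∨ b ∉ Set.range (circIndex k) := by
  have hj := j.isLt
  simp only [mem_range_circIndex hn]
  have hne : ∀ l : Fin n, l ≠ j → l.val ≠ j.val := fun l h e => h (Fin.ext e)
  by_cases h0 : j.val = 0
  · refine ⟨⟨n - 1, by omega⟩, j, ?_, by omega, fun k hk => ?_⟩
    · simp only; omega
    · have := hne k hk
      have := k.isLt
      simp only; omega
  · refine ⟨⟨j.val - 1, by omega⟩, j, ?_, by omega, fun k hk => ?_⟩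
    · simp only; omega
    · have := hne k hk
      have := k.isLt
      simp only; omega

end Combinatorics

/-! ### Determinant and adjugate at corank one. -/

section CorankOne

variable {m : Type*} [Fintype m]

lemma Matrix.IsSymm.dotProduct_mulVec_comm {A : Matrix m m ℝ} (hA : A.IsSymm) (x y : m → ℝ) :
    x ⬝ᵥ (A *ᵥ y) = y ⬝ᵥ (A *ᵥ x) := by
  rw [Matrix.dotProduct_mulVec, ← Matrix.mulVec_transpose, hA.eq, dotProduct_comm]

lemma Matrix.IsSymm.quadForm_add {A : Matrix m m ℝ} (hA : A.IsSymm) (x y : m → ℝ) (t : ℝ) :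
    (x + t • y) ⬝ᵥ (A *ᵥ (x + t • y)) =
      x ⬝ᵥ (A *ᵥ x) + 2 * t * (y ⬝ᵥ (A *ᵥ x)) + t ^ 2 * (y ⬝ᵥ (A *ᵥ y)) := by
  simp only [Matrix.mulVec_add, Matrix.mulVec_smul, dotProduct_add, add_dotProduct,
    smul_dotProduct, dotProduct_smul, smul_eq_mul]
  rw [hA.dotProduct_mulVec_comm x y]
  ring

/-- `B` is positive semidefinite and its kernel is spanned by `w ≠ 0`. -/
structure IsCorankOne (B : Matrix m m ℝ) (w : m → ℝ) : Prop where
  symm : B.IsSymm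
  nonneg : ∀ y, 0 ≤ y ⬝ᵥ (B *ᵥ y)
  ker : B *ᵥ w = 0
  ne_zero : w ≠ 0
  prop : ∀ y, y ⬝ᵥ (B *ᵥ y) = 0 → ∃ c : ℝ, y = c • w

namespace IsCorankOne

variable {B : Matrix m m ℝ} {w : m → ℝ}

lemma posSemidef (h : IsCorankOne B w) : B.PosSemidef :=
  Matrix.PosSemidef.of_dotProduct_mulVec_nonneg (by simpa using h.symm)
    (by simpa using h.nonneg)

lemma dot_pos (h : IsCorankOne B w) : 0 < w ⬝ᵥ w := by
  have := Matrix.dotProduct_star_self_pos_iff (v := w)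
  simpa using this.mpr h.ne_zero

lemma posDef_add (h : IsCorankOne B w) : (B + Matrix.vecMulVec w w).PosDef := by
  refine Matrix.PosDef.of_dotProduct_mulVec_pos ?_ ?_
  · have h1 : B.IsHermitian := by simpa using h.symm
    have h2 : (Matrix.vecMulVec w w).IsHermitian := by
      ext i j; simp [Matrix.vecMulVec_apply, mul_comm]
    exact h1.add h2
  · intro x hx
    have e : star x ⬝ᵥ ((B + Matrix.vecMulVec w w) *ᵥ x) = x ⬝ᵥ (B *ᵥ x) + (w ⬝ᵥ x) ^ 2 := by
      simp only [star_trivial, Matrix.add_mulVec, dotProduct_add, Matrix.vecMulVec_mulVec,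
        op_smul_eq_smul, dotProduct_smul, smul_eq_mul, dotProduct_comm x w]
      ring
    rw [e]
    rcases (h.nonneg x).lt_or_eq with h1 | h1
    · positivity
    · obtain ⟨c, rfl⟩ := h.prop x h1.symm
      have hc : c ≠ 0 := by rintro rfl; simp at hx
      have hw := h.dot_pos
      rw [← h1, zero_add, dotProduct_smul, smul_eq_mul]
      positivity

end IsCorankOne

variable [DecidableEq m]

/-- The rank-one determinant formula for positive semidefinite matrices. -/
lemma Matrix.PosSemidef.det_add_vecMulVec {B : Matrix m m ℝ} (hB : B.PosSemidef) (w : m → ℝ) :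
    (B + Matrix.vecMulVec w w).det = B.det + w ⬝ᵥ (B.adjugate *ᵥ w) := by
  -- `B` may be singular: shift it by `s > 0`, use the invertible case, and let `s` tend to `0`.
  have key : ∀ s : ℝ, s ∈ Set.Ioi (0 : ℝ) →
      (B + s • 1 + Matrix.vecMulVec w w).det =
        (B + s • 1).det + w ⬝ᵥ ((B + s • (1 : Matrix m m ℝ)).adjugate *ᵥ w) := by
    intro s hs
    have hpd : (B + s • (1 : Matrix m m ℝ)).PosDef :=
      Matrix.PosDef.posSemidef_add hB (Matrix.PosDef.one.smul hs)
    have hdet := hpd.det_pos.ne'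
    have h := Matrix.det_add_replicateCol_mul_replicateRow (ι := Unit)
      (isUnit_iff_ne_zero.mpr hdet) w w
    have h2 : Matrix.replicateCol Unit w * Matrix.replicateRow Unit w = Matrix.vecMulVec w w := by
      ext i j; simp [Matrix.mul_apply, Matrix.vecMulVec_apply]
    rw [h2] at h
    rw [h, Matrix.det_unique (n := Unit), Matrix.inv_def]
    have h3 : (Matrix.replicateRow Unit w * (Ring.inverse (B + s • (1 : Matrix m m ℝ)).det •
        (B + s • (1 : Matrix m m ℝ)).adjugate) * Matrix.replicateCol Unit w) default default =
        (B + s • (1 : Matrix m m ℝ)).det⁻¹ *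
          (w ⬝ᵥ ((B + s • (1 : Matrix m m ℝ)).adjugate *ᵥ w)) := by
      rw [Matrix.mul_smul, Matrix.smul_mul, Matrix.smul_apply, Matrix.mul_assoc,
        Ring.inverse_eq_inv', smul_eq_mul]
      rfl
    rw [Matrix.add_apply, h3, Matrix.one_apply_eq]
    field_simp
  have hc1 : Continuous fun s : ℝ => (B + s • (1 : Matrix m m ℝ) + Matrix.vecMulVec w w).det := by
    fun_prop
  have hc2 : Continuous fun s : ℝ => (B + s • (1 : Matrix m m ℝ)).det +
      w ⬝ᵥ ((B + s • (1 : Matrix m m ℝ)).adjugate *ᵥ w) := by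
    have : Continuous fun s : ℝ => (B + s • (1 : Matrix m m ℝ)).adjugate :=
      Continuous.matrix_adjugate (by fun_prop)
    fun_prop
  have hcl : Set.EqOn _ _ (closure (Set.Ioi (0 : ℝ))) := Set.EqOn.closure key hc1 hc2
  have := hcl (show (0 : ℝ) ∈ closure (Set.Ioi (0 : ℝ)) by simp)
  simpa using this

namespace IsCorankOne

variable {B : Matrix m m ℝ} {w : m → ℝ}

lemma det_eq_zero (h : IsCorankOne B w) : B.det = 0 :=
  Matrix.exists_mulVec_eq_zero_iff.mp ⟨w, h.ne_zero, h.ker⟩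

/-- Since `B * adjugate B = 0`, the columns of the adjugate lie on the line of `w`, and symmetry
forces a multiple of `w wᵀ`. The sign comes from `det (B + w wᵀ) > 0` and the rank-one formula. -/
lemma adjugate_eq (h : IsCorankOne B w) :
    ∃ c : ℝ, 0 < c ∧ B.adjugate = c • Matrix.vecMulVec w w := by
  have hw := h.dot_pos
  have hsymm : B.adjugate.IsSymm := by
    rw [Matrix.IsSymm, Matrix.adjugate_transpose, h.symm.eq]
  have hcol : ∀ b, ∃ d : ℝ, (fun a => B.adjugate a b) = d • w := by
    intro b
    refine h.prop _ ?_
    have : B *ᵥ (fun a => B.adjugate a b) = 0 := by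
      ext i
      have := congrFun (congrFun (Matrix.mul_adjugate B) i) b
      rw [h.det_eq_zero, zero_smul] at this
      exact this
    rw [this, dotProduct_zero]
  choose d hd using hcol
  have hab : ∀ a b, B.adjugate a b = d b * w a := fun a b => congrFun (hd b) a
  have hdw : ∀ b, d b * (w ⬝ᵥ w) = w b * (d ⬝ᵥ w) := by
    intro b
    simp only [dotProduct, Finset.mul_sum]
    refine Finset.sum_congr rfl fun a _ => ?_
    have := hsymm.apply a b
    rw [hab, hab] at this
    linear_combination (-w a) * this
  have hadj : B.adjugate = ((d ⬝ᵥ w) / (w ⬝ᵥ w)) • Matrix.vecMulVec w w := by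
    ext a b
    rw [hab, Matrix.smul_apply, Matrix.vecMulVec_apply, smul_eq_mul]
    field_simp
    linear_combination (w a) * hdw b
  refine ⟨_, ?_, hadj⟩
  have hdet := h.posSemidef.det_add_vecMulVec w
  rw [h.det_eq_zero, zero_add] at hdet
  have hpos := h.posDef_add.det_pos
  rw [hdet, hadj, Matrix.smul_mulVec, dotProduct_smul, Matrix.vecMulVec_mulVec,
    op_smul_eq_smul, dotProduct_smul, smul_eq_mul, smul_eq_mul] at hpos
  exact (pos_iff_pos_of_mul_pos hpos).mpr (by positivity)

/-- The derivative of the determinant at a matrix of corank one. -/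
lemma hasDerivAt_det (h : IsCorankOne B w) :
    ∃ c : ℝ, 0 < c ∧ ∀ H : Matrix m m ℝ,
      HasDerivAt (fun t : ℝ => (B + t • H).det) (c * (w ⬝ᵥ (H *ᵥ w))) 0 := by
  obtain ⟨c, hc, hadj⟩ := h.adjugate_eq
  have hw := h.dot_pos
  refine ⟨c, hc, fun H => ?_⟩
  -- Applying the adjugate of `B + t • H` to `(B + t • H) *ᵥ w = t • (H *ᵥ w)` exhibits the
  -- determinant as `t * g t` with `g` continuous; the derivative is `g 0`.
  set g : ℝ → ℝ := fun t => (w ⬝ᵥ ((B + t • H).adjugate *ᵥ (H *ᵥ w))) / (w ⬝ᵥ w) with hg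
  have hf : ∀ t : ℝ, (B + t • H).det = t * g t := by
    intro t
    have e : (B + t • H).adjugate *ᵥ ((B + t • H) *ᵥ w) = (B + t • H).det • w := by
      rw [Matrix.mulVec_mulVec, Matrix.adjugate_mul, Matrix.smul_mulVec, Matrix.one_mulVec]
    rw [Matrix.add_mulVec, h.ker, zero_add, Matrix.smul_mulVec, Matrix.mulVec_smul] at e
    have e2 := congrArg (fun v => w ⬝ᵥ v) e
    simp only [dotProduct_smul, smul_eq_mul] at e2
    rw [hg]
    field_simp
    linarith
  have hgc : Continuous g := by
    have : Continuous fun t : ℝ => (B + t • H).adjugate :=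
      Continuous.matrix_adjugate (by fun_prop)
    fun_prop
  have hg0 : g 0 = c * (w ⬝ᵥ (H *ᵥ w)) := by
    simp only [hg, zero_smul, add_zero, hadj, Matrix.smul_mulVec, dotProduct_smul,
      Matrix.vecMulVec_mulVec, op_smul_eq_smul, smul_eq_mul]
    field_simp
  rw [← hg0, hasDerivAt_iff_tendsto_slope]
  have : Filter.Tendsto g (𝓝[≠] 0) (𝓝 (g 0)) := hgc.continuousAt.tendsto.mono_left nhdsWithin_le_nhds
  refine this.congr' ?_
  filter_upwards [self_mem_nhdsWithin] with t ht
  have ht : t ≠ 0 := ht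
  rw [slope_def_field, hf, hf]
  field_simp
  ring

end IsCorankOne

end CorankOne

/-! ### Zeros of copositive matrices and strict complementarity. -/

section ZeroSystem

variable {n : ℕ} {A : Matrix (Fin n) (Fin n) ℝ}

lemma IsCopositive.mulVec_nonneg (hA : IsCopositive A) {u : Fin n → ℝ} (hu : IsZeroOf A u)
    (i : Fin n) : 0 ≤ (A *ᵥ u) i := by
  by_contra! hneg
  have key : ∀ t : ℝ, 0 < t → 0 ≤ 2 * (A *ᵥ u) i + t * A i i := by
    intro t ht
    have h := hA.2 (u + t • Pi.single i 1) (fun k => by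
      have h1 := hu.2.1 k
      have h2 : (0 : ℝ) ≤ (Pi.single i 1 : Fin n → ℝ) k := by
        by_cases hk : k = i
        · subst hk; simp
        · simp [hk]
      simp only [Pi.add_apply, Pi.smul_apply, smul_eq_mul]
      positivity)
    rw [hA.1.quadForm_add, hu.2.2] at h
    simp only [single_one_dotProduct, Matrix.mulVec_single_one, Matrix.col_apply] at h
    have : 0 ≤ t * (2 * (A *ᵥ u) i + t * A i i) := by linarith
    exact nonneg_of_mul_nonneg_right this ht
  -- This step is short enough for the quadratic term to offset at most half of the linear decrease.
  have h := key (-(A *ᵥ u) i / (|A i i| + 1)) (div_pos (neg_pos.mpr hneg) (by positivity))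
  have h2 : -(A *ᵥ u) i / (|A i i| + 1) * A i i ≤ -(A *ᵥ u) i := by
    rw [div_mul_eq_mul_div, div_le_iff₀ (by positivity)]
    have := le_abs_self (A i i)
    nlinarith
  linarith

lemma IsCopositive.mulVec_eq_zero (hA : IsCopositive A) {u : Fin n → ℝ} (hu : IsZeroOf A u)
    {i : Fin n} (hi : 0 < u i) : (A *ᵥ u) i = 0 := by
  have h := hu.2.2
  rw [dotProduct, Finset.sum_eq_zero_iff_of_nonneg
    (fun k _ => mul_nonneg (hu.2.1 k) (hA.mulVec_nonneg hu k))] at h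
  exact (mul_eq_zero.mp (h i (Finset.mem_univ i))).resolve_left hi.ne'

/-- `A` is copositive, and its zeros are, up to scaling, the vectors `u j` with supports `I_j`. -/
structure IsCircZeroSystem (A : Matrix (Fin n) (Fin n) ℝ) (u : Fin n → Fin n → ℝ) : Prop where
  cop : IsCopositive A
  zero : ∀ j, IsZeroOf A (u j)
  supp : ∀ j, vecSupp (u j) = Set.range (circIndex j)
  prop : ∀ v, IsZeroOf A v → ∃ (j : Fin n) (c : ℝ), v = c • u j

lemma sum_eq_sum_comp_circIndex (hn : 5 ≤ n) (j : Fin n) {f : Fin n → ℝ}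
    (hf : ∀ i, i ∉ Set.range (circIndex j) → f i = 0) :
    ∑ i, f i = ∑ k, f (circIndex j k) :=
  (Fintype.sum_of_injective (circIndex j) (circIndex_injective hn j) _ _ hf fun _ => rfl).symm

lemma circSub_mulVec (hn : 5 ≤ n) (A : Matrix (Fin n) (Fin n) ℝ) (j : Fin n) {x : Fin n → ℝ}
    (hx : ∀ i, i ∉ Set.range (circIndex j) → x i = 0) (k : Fin (n - 2)) :
    (circSub A j *ᵥ (x ∘ circIndex j)) k = (A *ᵥ x) (circIndex j k) := by
  simp only [Matrix.mulVec, dotProduct]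
  rw [sum_eq_sum_comp_circIndex hn j (fun i hi => by rw [hx i hi, mul_zero])]
  rfl

lemma quadForm_circSub (hn : 5 ≤ n) (A : Matrix (Fin n) (Fin n) ℝ) (j : Fin n) {x : Fin n → ℝ}
    (hx : ∀ i, i ∉ Set.range (circIndex j) → x i = 0) :
    (x ∘ circIndex j) ⬝ᵥ (circSub A j *ᵥ (x ∘ circIndex j)) = x ⬝ᵥ (A *ᵥ x) := by
  simp only [dotProduct, circSub_mulVec hn A j hx]
  rw [sum_eq_sum_comp_circIndex hn j (fun i hi => by rw [hx i hi, zero_mul])]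
  rfl

lemma circSub_isSymm (hA : A.IsSymm) (j : Fin n) : (circSub A j).IsSymm :=
  hA.submatrix _

namespace IsCircZeroSystem

variable {u : Fin n → Fin n → ℝ}

lemma pos_iff (h : IsCircZeroSystem A u) {i j : Fin n} :
    0 < u j i ↔ i ∈ Set.range (circIndex j) := by
  rw [← h.supp j]; rfl

lemma eq_zero (h : IsCircZeroSystem A u) {i j : Fin n} (hi : i ∉ Set.range (circIndex j)) :
    u j i = 0 :=
  le_antisymm (not_lt.mp fun hp => hi (h.pos_iff.mp hp)) ((h.zero j).2.1 i)

lemma eq_smul_of_supp (hn : 5 ≤ n) (h : IsCircZeroSystem A u) {v : Fin n → ℝ}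
    (hv : IsZeroOf A v) {j : Fin n} (hs : ∀ i, 0 < v i ↔ i ∈ Set.range (circIndex j)) :
    ∃ c : ℝ, v = c • u j := by
  obtain ⟨k, c, rfl⟩ := h.prop v hv
  refine ⟨c, ?_⟩
  have hjk : Set.range (circIndex j) = Set.range (circIndex k) := by
    have hc : 0 < c := by
      have h0 : circIndex j ⟨0, by omega⟩ ∈ Set.range (circIndex j) := ⟨_, rfl⟩
      have h1 := (hs _).mpr h0
      exact pos_of_mul_pos_left h1 ((h.zero k).2.1 _)
    ext i
    rw [← hs, ← h.pos_iff, Pi.smul_apply, smul_eq_mul, mul_pos_iff_of_pos_left hc]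
  rw [circIndex_range_inj hn hjk]

lemma mulVec_eq_zero (h : IsCircZeroSystem A u) {i j : Fin n}
    (hi : i ∈ Set.range (circIndex j)) : (A *ᵥ u j) i = 0 :=
  h.cop.mulVec_eq_zero (h.zero j) (h.pos_iff.mpr hi)

/-- Strict complementarity: `A u^j` is positive outside the support of `u^j`. -/
lemma mulVec_pos (hn : 5 ≤ n) (h : IsCircZeroSystem A u) {i j : Fin n}
    (hi : i ∉ Set.range (circIndex j)) : 0 < (A *ᵥ u j) i := by
  refine (h.cop.mulVec_nonneg (h.zero j) i).lt_of_ne fun h0 => ?_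
  obtain ⟨k, hik, hk⟩ := exists_circIndex_adjacent hn hi
  have hkj : u k ⬝ᵥ (A *ᵥ u j) = 0 := by
    refine Finset.sum_eq_zero fun l _ => ?_
    by_cases hl : l ∈ Set.range (circIndex k)
    · by_cases hli : l = i
      · rw [hli, ← h0, mul_zero]
      · rw [h.mulVec_eq_zero (hk l hl hli), mul_zero]
    · rw [h.eq_zero hl, zero_mul]
  have hz : IsZeroOf A (u j + (1 : ℝ) • u k) := by
    have hnn : ∀ l, 0 ≤ (u j + (1 : ℝ) • u k) l := fun l => by
      have h1 := (h.zero j).2.1 l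
      have h2 := (h.zero k).2.1 l
      simpa using add_nonneg h1 h2
    refine ⟨fun h1 => ?_, hnn, ?_⟩
    · have h2 := congrFun h1 i
      simp only [Pi.add_apply, Pi.smul_apply, smul_eq_mul, one_mul, Pi.zero_apply] at h2
      have := h.pos_iff.mpr hik
      have := (h.zero j).2.1 i
      linarith
    · rw [h.cop.1.quadForm_add, (h.zero j).2.2, (h.zero k).2.2, hkj]; ring
  obtain ⟨l, c, hc⟩ := h.prop _ hz
  have hsup : ∀ a, a ∈ Set.range (circIndex j) ∨ a = i → a ∈ Set.range (circIndex l) := by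
    intro a ha
    by_contra hal
    have h1 := congrFun hc a
    simp only [Pi.add_apply, Pi.smul_apply, smul_eq_mul, one_mul, h.eq_zero hal, mul_zero] at h1
    have h2 := (h.zero j).2.1 a
    have h3 := (h.zero k).2.1 a
    rcases ha with ha | rfl
    · have := h.pos_iff.mpr ha
      linarith
    · have := h.pos_iff.mpr hik
      linarith
  have hcard : Set.range (circIndex j) = Set.range (circIndex l) := by
    -- All index sets have `n - 2` elements, so the support of the new zero cannot also contain `i`.
    refine Set.eq_of_subset_of_ncard_le (fun a ha => hsup a (Or.inl ha)) ?_ (Set.toFinite _)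
    rw [← Set.image_univ, ← Set.image_univ,
      Set.ncard_image_of_injective _ (circIndex_injective hn _),
      Set.ncard_image_of_injective _ (circIndex_injective hn _)]
  exact hi (hcard ▸ hsup i (Or.inr rfl))

/-- A vector supported in `I_j` has a positive multiple that `u^j` dominates. -/
lemma exists_pos_add (h : IsCircZeroSystem A u) (j : Fin n) {v : Fin n → ℝ}
    (hv : ∀ i, i ∉ Set.range (circIndex j) → v i = 0) :
    ∃ t : ℝ, 0 < t ∧ ∀ i, 0 < (u j + t • v) i ↔ i ∈ Set.range (circIndex j) := by
  have hev : ∀ᶠ t : ℝ in 𝓝[>] 0, ∀ i, 0 < (u j + t • v) i ↔ i ∈ Set.range (circIndex j) := by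
    rw [Filter.eventually_all]
    intro i
    by_cases hi : i ∈ Set.range (circIndex j)
    · have hc : ContinuousAt (fun t : ℝ => (u j + t • v) i) 0 := by
        simp only [Pi.add_apply, Pi.smul_apply]; fun_prop
      have : ∀ᶠ t : ℝ in 𝓝 0, 0 < (u j + t • v) i :=
        hc.eventually_const_lt (by simpa using h.pos_iff.mpr hi)
      filter_upwards [this.filter_mono nhdsWithin_le_nhds] with t ht
      exact ⟨fun _ => hi, fun _ => ht⟩
    · refine Filter.Eventually.of_forall fun t => ?_
      simp [h.eq_zero hi, hv i hi, hi]
  obtain ⟨t, ht, ht0⟩ := (hev.and self_mem_nhdsWithin).exists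
  exact ⟨t, ht0, ht⟩

/-- For `v` supported in `I_j` and small `t > 0`, the form at `u j + t • v` equals `t ^ 2` times the
form at `v`, since the cross term vanishes. Copositivity gives the sign; if the value is zero, a new
zero with support `I_j` arises, hence a multiple of `u j`. -/
lemma isCorankOne (hn : 5 ≤ n) (h : IsCircZeroSystem A u) (j : Fin n) :
    IsCorankOne (circSub A j) (u j ∘ circIndex j) := by
  have hu0 : ∀ i, i ∉ Set.range (circIndex j) → u j i = 0 := fun i hi => h.eq_zero hi
  have key : ∀ y : Fin (n - 2) → ℝ, ∃ v : Fin n → ℝ, v ∘ circIndex j = y ∧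
      (∀ i, i ∉ Set.range (circIndex j) → v i = 0) ∧
      ∃ t : ℝ, 0 < t ∧ (∀ i, 0 < (u j + t • v) i ↔ i ∈ Set.range (circIndex j)) ∧
        (∀ i, 0 ≤ (u j + t • v) i) ∧
        (u j + t • v) ⬝ᵥ (A *ᵥ (u j + t • v)) = t ^ 2 * (y ⬝ᵥ (circSub A j *ᵥ y)) := by
    intro y
    have hinj := circIndex_injective hn j
    have hv0 : ∀ i, i ∉ Set.range (circIndex j) → Function.extend (circIndex j) y 0 i = 0 :=
      fun i hi => Function.extend_apply' _ _ _ fun ⟨k, hk⟩ => hi ⟨k, hk⟩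
    obtain ⟨t, ht, hs⟩ := h.exists_pos_add j hv0
    refine ⟨Function.extend (circIndex j) y 0, Function.extend_comp hinj y 0, hv0, t, ht, hs,
      fun i => ?_, ?_⟩
    · by_cases hi : i ∈ Set.range (circIndex j)
      · exact ((hs i).mpr hi).le
      · simp [hu0 i hi, hv0 i hi]
    · have hcross : Function.extend (circIndex j) y 0 ⬝ᵥ (A *ᵥ u j) = 0 := by
        refine Finset.sum_eq_zero fun l _ => ?_
        by_cases hl : l ∈ Set.range (circIndex j)
        · rw [h.mulVec_eq_zero hl, mul_zero]
        · rw [hv0 l hl, zero_mul]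
      rw [h.cop.1.quadForm_add, (h.zero j).2.2, hcross, ← quadForm_circSub hn A j hv0,
        Function.extend_comp hinj]
      ring
  refine ⟨circSub_isSymm h.cop.1 j, fun y => ?_, ?_, fun h0 => ?_, fun y hy => ?_⟩
  · obtain ⟨v, -, -, t, ht, -, hnn, hq⟩ := key y
    have := h.cop.2 _ hnn
    rw [hq] at this
    exact nonneg_of_mul_nonneg_right this (by positivity)
  · ext k
    rw [circSub_mulVec hn A j hu0]
    exact h.mulVec_eq_zero ⟨k, rfl⟩
  · have h1 := congrFun h0 ⟨0, by omega⟩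
    exact (h.pos_iff.mpr (Set.mem_range_self (f := circIndex j) ⟨0, by omega⟩)).ne' h1
  · obtain ⟨v, hvy, -, t, ht, hs, hnn, hq⟩ := key y
    rw [hy, mul_zero] at hq
    have hz : IsZeroOf A (u j + t • v) := by
      refine ⟨fun h0 => ?_, hnn, hq⟩
      have := (hs _).mpr (Set.mem_range_self (f := circIndex j) ⟨0, by omega⟩)
      rw [h0] at this
      exact lt_irrefl _ this
    obtain ⟨c, hc⟩ := h.eq_smul_of_supp hn hz hs
    refine ⟨(c - 1) / t, ?_⟩
    rw [← hvy]
    ext k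
    have := congrFun hc (circIndex j k)
    simp only [Pi.add_apply, Pi.smul_apply, smul_eq_mul, Function.comp_apply] at this ⊢
    field_simp
    linarith

/-- In a splitting `P + N` both forms vanish at every `u j`. Any two indices share some `I_j`, so `N
= 0`; then `P *ᵥ u j = 0` contradicts strict complementarity. -/
lemma isExceptional (hn : 5 ≤ n) (h : IsCircZeroSystem A u) : IsExceptional A := by
  refine ⟨h.cop, ?_⟩
  rintro ⟨P, N, hP, ⟨hN, hN0⟩, rfl⟩
  have hNu : ∀ j a, 0 ≤ (N *ᵥ u j) a := fun j a => by
    rw [Matrix.mulVec]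
    exact Finset.sum_nonneg fun b _ => mul_nonneg (hN0 a b) ((h.zero j).2.1 b)
  have hsplit : ∀ j, u j ⬝ᵥ (P *ᵥ u j) = 0 ∧ u j ⬝ᵥ (N *ᵥ u j) = 0 := by
    intro j
    have h1 : 0 ≤ u j ⬝ᵥ (P *ᵥ u j) := by simpa using hP.dotProduct_mulVec_nonneg (u j)
    have h2 : 0 ≤ u j ⬝ᵥ (N *ᵥ u j) :=
      Finset.sum_nonneg fun i _ => mul_nonneg ((h.zero j).2.1 i) (hNu j i)
    have h3 := (h.zero j).2.2
    rw [Matrix.add_mulVec, dotProduct_add] at h3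
    constructor <;> linarith
  have hNz : N = 0 := by
    ext i k
    obtain ⟨j, hi, hk⟩ := exists_circIndex_pair hn i k
    have h2 := (hsplit j).2
    rw [dotProduct, Finset.sum_eq_zero_iff_of_nonneg
      (fun a _ => mul_nonneg ((h.zero j).2.1 a) (hNu j a))] at h2
    have h3 := (mul_eq_zero.mp (h2 i (Finset.mem_univ i))).resolve_left (h.pos_iff.mpr hi).ne'
    rw [Matrix.mulVec, dotProduct, Finset.sum_eq_zero_iff_of_nonneg
      (fun b _ => mul_nonneg (hN0 i b) ((h.zero j).2.1 b))] at h3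
    exact (mul_eq_zero.mp (h3 k (Finset.mem_univ k))).resolve_right (h.pos_iff.mpr hk).ne'
  obtain ⟨a, b, ha, -⟩ := exists_circIndex_separating hn ⟨0, by omega⟩
  have h1 := h.mulVec_pos hn ha
  have h2 : P *ᵥ u ⟨0, by omega⟩ = 0 := by
    rw [← hP.dotProduct_mulVec_zero_iff]
    simpa using (hsplit _).1
  rw [hNz, add_zero, h2] at h1
  exact lt_irrefl _ h1

lemma hasMinimalCirculantZeroSupport (hn : 5 ≤ n) (h : IsCircZeroSystem A u) :
    HasMinimalCirculantZeroSupport A :=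
  ⟨h.isExceptional hn, u, fun j => ⟨h.zero j, h.supp j⟩, h.prop⟩

/-- The symmetric matrix `H` along which only the `j`-th determinant varies to first order. -/
lemma exists_direction (hn : 5 ≤ n) (h : IsCircZeroSystem A u) (j : Fin n) :
    ∃ H : Matrix (Fin n) (Fin n) ℝ, H.IsSymm ∧ u j ⬝ᵥ (H *ᵥ u j) ≠ 0 ∧
      ∀ k, k ≠ j → u k ⬝ᵥ (H *ᵥ u k) = 0 := by
  obtain ⟨a, b, ha, hb, hab⟩ := exists_circIndex_separating hn j
  -- The form of `G` at `u k` is `u k b * (A *ᵥ u k) a`: for `k ≠ j` one factor vanishes, while for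
  -- `k = j` both are positive.
  set G : Matrix (Fin n) (Fin n) ℝ := Matrix.vecMulVec (Pi.single b 1) (A a) with hG
  have hq : ∀ k, u k ⬝ᵥ ((G + Gᵀ) *ᵥ u k) = 2 * (u k b * (A *ᵥ u k) a) := by
    intro k
    have h1 : u k ⬝ᵥ (G *ᵥ u k) = u k b * (A *ᵥ u k) a := by
      rw [hG, Matrix.vecMulVec_mulVec, op_smul_eq_smul, dotProduct_smul, dotProduct_single_one,
        smul_eq_mul, mul_comm]
      rfl
    have h2 : u k ⬝ᵥ (Gᵀ *ᵥ u k) = u k ⬝ᵥ (G *ᵥ u k) := by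
      rw [Matrix.mulVec_transpose, Matrix.dotProduct_mulVec, dotProduct_comm]
    rw [Matrix.add_mulVec, dotProduct_add, h2, h1]; ring
  refine ⟨G + Gᵀ, Matrix.isSymm_add_transpose_self G, ?_, fun k hk => ?_⟩
  · rw [hq]
    have h1 := h.mulVec_pos hn ha
    have h2 := h.pos_iff.mpr hb
    positivity
  · rw [hq]
    rcases hab k hk with h1 | h1
    · rw [h.mulVec_eq_zero h1]; ring
    · rw [h.eq_zero h1]; ring

end IsCircZeroSystem

end ZeroSystem

/-! ### Persistence of the zeros under perturbation. -/

section Perturbation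

/-- A singular matrix that is positive definite modulo `w` has corank one. -/
lemma IsCorankOne.of_pos {m : Type*} [Fintype m] {B : Matrix m m ℝ} {v w : m → ℝ}
    (hB : B.IsSymm) (hv : B *ᵥ v = 0) (hvw : w ⬝ᵥ v ≠ 0)
    (hpos : ∀ y, y ≠ 0 → 0 < y ⬝ᵥ (B *ᵥ y) + (w ⬝ᵥ y) ^ 2) : IsCorankOne B v := by
  -- Subtracting a multiple of the kernel vector `v` moves `y` into the hyperplane `w ⬝ᵥ z = 0`
  -- without changing the form.
  have key : ∀ y, ∃ z, w ⬝ᵥ z = 0 ∧ (∃ c : ℝ, y = c • v + z) ∧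
      y ⬝ᵥ (B *ᵥ y) = z ⬝ᵥ (B *ᵥ z) := by
    intro y
    refine ⟨y + (-((w ⬝ᵥ y) / (w ⬝ᵥ v))) • v, ?_, ⟨(w ⬝ᵥ y) / (w ⬝ᵥ v), ?_⟩, ?_⟩
    · rw [dotProduct_add, dotProduct_smul, smul_eq_mul]
      field_simp
      ring
    · rw [neg_smul]; abel
    · rw [hB.quadForm_add, hB.dotProduct_mulVec_comm v y, hv]
      simp
  refine ⟨hB, fun y => ?_, hv, fun h => hvw (by rw [h, dotProduct_zero]), fun y hy => ?_⟩
  · obtain ⟨z, hz, -, hq⟩ := key y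
    rw [hq]
    by_cases h0 : z = 0
    · simp [h0]
    · simpa [hz] using (hpos z h0).le
  · obtain ⟨z, hz, ⟨c, hc⟩, hq⟩ := key y
    rw [hq] at hy
    by_cases h0 : z = 0
    · exact ⟨c, by rw [hc, h0, add_zero]⟩
    · have := hpos z h0
      rw [hy, hz] at this
      simp at this

/-- Positive definiteness is an open condition. -/
lemma eventually_quadForm_pos {m : Type*} [Fintype m] {B : Matrix m m ℝ} {w : m → ℝ}
    (hB : ∀ y, y ≠ 0 → 0 < y ⬝ᵥ (B *ᵥ y) + (w ⬝ᵥ y) ^ 2) :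
    ∀ᶠ C : Matrix m m ℝ in 𝓝 B, ∀ y, y ≠ 0 → 0 < y ⬝ᵥ (C *ᵥ y) + (w ⬝ᵥ y) ^ 2 := by
  have hev : ∀ᶠ C : Matrix m m ℝ in 𝓝 B, ∀ y ∈ Metric.sphere (0 : m → ℝ) 1,
      0 < y ⬝ᵥ (C *ᵥ y) + (w ⬝ᵥ y) ^ 2 := by
    refine (isCompact_sphere _ _).eventually_forall_of_forall_eventually fun y hy => ?_
    have hc : Continuous fun p : Matrix m m ℝ × (m → ℝ) =>
        p.2 ⬝ᵥ (p.1 *ᵥ p.2) + (w ⬝ᵥ p.2) ^ 2 := by fun_prop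
    refine hc.continuousAt.eventually_const_lt (hB y ?_)
    rintro rfl
    simp at hy
  filter_upwards [hev] with C hC y hy
  have hny : 0 < ‖y‖ := norm_pos_iff.mpr hy
  have h := hC (‖y‖⁻¹ • y) (by simp [norm_smul, hny.ne'])
  have e : (‖y‖⁻¹ • y) ⬝ᵥ (C *ᵥ (‖y‖⁻¹ • y)) + (w ⬝ᵥ (‖y‖⁻¹ • y)) ^ 2 =
      (‖y‖⁻¹) ^ 2 * (y ⬝ᵥ (C *ᵥ y) + (w ⬝ᵥ y) ^ 2) := by
    simp only [Matrix.mulVec_smul, smul_dotProduct, dotProduct_smul, smul_eq_mul]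
    ring
  rw [e] at h
  exact pos_of_mul_pos_right h (by positivity)

variable {n : ℕ}

/-- The kernel vector of `A_{I_j}` that depends continuously on `A`. -/
noncomputable def subKernel (u : Fin n → Fin n → ℝ) (A : Matrix (Fin n) (Fin n) ℝ) (j : Fin n) :
    Fin (n - 2) → ℝ :=
  (circSub A j).adjugate *ᵥ (u j ∘ circIndex j)

/-- `subKernel` extended by zero to a vector supported in `I_j`. -/
noncomputable def perturbedZero (u : Fin n → Fin n → ℝ) (A : Matrix (Fin n) (Fin n) ℝ)
    (j : Fin n) : Fin n → ℝ :=
  Function.extend (circIndex j) (subKernel u A j) 0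

lemma continuous_circSub (j : Fin n) :
    Continuous fun A : Matrix (Fin n) (Fin n) ℝ => circSub A j :=
  continuous_id.matrix_submatrix _ _

namespace IsCircZeroSystem

variable {A : Matrix (Fin n) (Fin n) ℝ} {u : Fin n → Fin n → ℝ}

lemma eventually_subKernel_pos (hn : 5 ≤ n) (h : IsCircZeroSystem A u) :
    ∀ᶠ C in 𝓝 A, ∀ j k, 0 < subKernel u C j k := by
  rw [Filter.eventually_all]
  intro j
  rw [Filter.eventually_all]
  intro k
  have hc : Continuous fun C => subKernel u C j k := by
    have : Continuous fun C : Matrix (Fin n) (Fin n) ℝ => (circSub C j).adjugate :=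
      (continuous_circSub j).matrix_adjugate
    exact (continuous_apply k).comp (this.matrix_mulVec continuous_const)
  refine hc.continuousAt.eventually_const_lt ?_
  have h1 := h.isCorankOne hn j
  obtain ⟨c, hc0, hadj⟩ := h1.adjugate_eq
  have h2 := h1.dot_pos
  have h3 : 0 < (u j ∘ circIndex j) k := h.pos_iff.mpr ⟨k, rfl⟩
  change 0 < ((circSub A j).adjugate *ᵥ (u j ∘ circIndex j)) k
  rw [hadj, Matrix.smul_mulVec, Matrix.vecMulVec_mulVec, op_smul_eq_smul]
  simp only [Pi.smul_apply, smul_eq_mul]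
  positivity

lemma eventually_isCorankOne (hn : 5 ≤ n) (h : IsCircZeroSystem A u) :
    ∀ᶠ C in 𝓝 A, C.IsSymm → (∀ j, (circSub C j).det = 0) → ∀ j,
      IsCorankOne (circSub C j) (subKernel u C j) := by
  have h1 : ∀ᶠ C in 𝓝 A, ∀ j, ∀ y, y ≠ 0 →
      0 < y ⬝ᵥ (circSub C j *ᵥ y) + ((u j ∘ circIndex j) ⬝ᵥ y) ^ 2 := by
    rw [Filter.eventually_all]
    intro j
    refine (continuous_circSub j).continuousAt.eventually (eventually_quadForm_pos fun y hy => ?_)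
    have hpd := (h.isCorankOne hn j).posDef_add.dotProduct_mulVec_pos hy
    simp only [star_trivial, Matrix.add_mulVec, dotProduct_add, Matrix.vecMulVec_mulVec,
      op_smul_eq_smul, dotProduct_smul, smul_eq_mul,
      dotProduct_comm y (u j ∘ circIndex j)] at hpd
    rwa [sq]
  filter_upwards [h1, h.eventually_subKernel_pos hn] with C hC hpos hsymm hdet j
  refine IsCorankOne.of_pos (circSub_isSymm hsymm j) ?_ ?_ (hC j)
  · rw [subKernel, Matrix.mulVec_mulVec, Matrix.mul_adjugate, hdet j, zero_smul,
      Matrix.zero_mulVec]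
  · have : Nonempty (Fin (n - 2)) := ⟨⟨0, by omega⟩⟩
    refine (Finset.sum_pos (fun k _ => mul_pos ?_ (hpos j k)) Finset.univ_nonempty).ne'
    exact h.pos_iff.mpr ⟨k, rfl⟩

/-- Copositivity and the shape of the zeros persist locally around a point of the simplex. -/
lemma eventually_local (hn : 5 ≤ n) (h : IsCircZeroSystem A u) {x : Fin n → ℝ}
    (hx : x ∈ stdSimplex ℝ (Fin n)) :
    ∀ᶠ p : Matrix (Fin n) (Fin n) ℝ × (Fin n → ℝ) in 𝓝 (A, x),
      p.1.IsSymm → (∀ j, (circSub p.1 j).det = 0) → (∀ i, 0 ≤ p.2 i) →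
      0 ≤ p.2 ⬝ᵥ (p.1 *ᵥ p.2) ∧
      (p.2 ⬝ᵥ (p.1 *ᵥ p.2) = 0 →
        ∃ (j : Fin n) (c : ℝ), p.2 = c • perturbedZero u p.1 j) := by
  rcases (h.cop.2 x hx.1).lt_or_eq with hq | hq
  · have hc : Continuous fun p : Matrix (Fin n) (Fin n) ℝ × (Fin n → ℝ) =>
        p.2 ⬝ᵥ (p.1 *ᵥ p.2) := by fun_prop
    filter_upwards [hc.continuousAt.eventually_const_lt hq] with p hp _ _ _
    exact ⟨hp.le, fun h0 => absurd h0 hp.ne'⟩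
  have hx0 : x ≠ 0 := by
    rintro rfl
    simpa using hx.2
  obtain ⟨j, c, rfl⟩ := h.prop x ⟨hx0, hx.1, hq.symm⟩
  have hc0 : 0 < c := by
    have h1 := h.pos_iff.mpr (Set.mem_range_self (f := circIndex j) ⟨0, by omega⟩)
    have h2 := hx.1 (circIndex j ⟨0, by omega⟩)
    rw [Pi.smul_apply, smul_eq_mul] at h2
    refine (nonneg_of_mul_nonneg_left h2 h1).lt_of_ne ?_
    rintro rfl
    simp at hx0
  classical
  set r : (Fin n → ℝ) → Fin n → ℝ := fun y i => if i ∈ Set.range (circIndex j) then y i else 0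
    with hr
  have hrc : Continuous r := by
    refine continuous_pi fun i => ?_
    by_cases hi : i ∈ Set.range (circIndex j)
    · simp only [hr, hi, if_true]; fun_prop
    · simp only [hr, hi, if_false]; fun_prop
  have hev : ∀ᶠ p : Matrix (Fin n) (Fin n) ℝ × (Fin n → ℝ) in 𝓝 (A, c • u j),
      ∀ i, i ∉ Set.range (circIndex j) → 0 < (p.1 *ᵥ (p.2 + r p.2)) i := by
    rw [Filter.eventually_all]
    intro i
    by_cases hi : i ∈ Set.range (circIndex j)
    · exact Filter.Eventually.of_forall fun p hp => absurd hi hp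
    have hc : Continuous fun p : Matrix (Fin n) (Fin n) ℝ × (Fin n → ℝ) =>
        (p.1 *ᵥ (p.2 + r p.2)) i := by
      have : Continuous fun p : Matrix (Fin n) (Fin n) ℝ × (Fin n → ℝ) => r p.2 :=
        hrc.comp continuous_snd
      fun_prop
    have hpos : 0 < (A *ᵥ (c • u j + r (c • u j))) i := by
      have e : r (c • u j) = c • u j := by
        ext l
        by_cases hl : l ∈ Set.range (circIndex j)
        · simp only [hr, hl, if_true]
        · simp only [hr, hl, if_false, Pi.smul_apply, h.eq_zero hl, smul_zero]
      rw [e, Matrix.mulVec_add, Matrix.mulVec_smul]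
      have := h.mulVec_pos hn hi
      simp only [Pi.add_apply, Pi.smul_apply, smul_eq_mul]
      positivity
    filter_upwards [hc.continuousAt.eventually_const_lt hpos] with p hp _ using hp
  have hfst : Filter.Tendsto Prod.fst (𝓝 (A, c • u j)) (𝓝 A) := continuous_fst.tendsto _
  filter_upwards [hev, hfst.eventually (h.eventually_isCorankOne hn)] with p hp hcor hsymm hdet hnn
  have hco := hcor hsymm hdet j
  obtain ⟨C, y⟩ := p
  simp only at hp hsymm hnn hco ⊢
  have hr0 : ∀ i, i ∉ Set.range (circIndex j) → r y i = 0 := fun i hi => by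
    simp only [hr, hi, if_false]
  have hry : r y ∘ circIndex j = y ∘ circIndex j := by
    ext k
    simp [hr]
  have hqr := quadForm_circSub hn C j hr0
  -- A difference of squares for the form: off `I_j` the factor `C *ᵥ (y + r y)` is close to `2c`
  -- times `A *ᵥ u j`, hence positive.
  have hsum : y ⬝ᵥ (C *ᵥ y) = r y ⬝ᵥ (C *ᵥ r y) + (y - r y) ⬝ᵥ (C *ᵥ (y + r y)) := by
    rw [Matrix.mulVec_add, dotProduct_add, sub_dotProduct, sub_dotProduct,
      hsymm.dotProduct_mulVec_comm (r y) y]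
    ring
  have hterm : ∀ i ∈ Finset.univ, 0 ≤ (y - r y) i * (C *ᵥ (y + r y)) i := by
    intro i _
    by_cases hi : i ∈ Set.range (circIndex j)
    · simp only [Pi.sub_apply, hr, hi, if_true, sub_self, zero_mul, le_refl]
    · rw [Pi.sub_apply, hr0 i hi, sub_zero]
      exact mul_nonneg (hnn i) (hp i hi).le
  have h1 : 0 ≤ r y ⬝ᵥ (C *ᵥ r y) := by
    rw [← hqr]; exact hco.nonneg _
  have h2 : 0 ≤ (y - r y) ⬝ᵥ (C *ᵥ (y + r y)) := Finset.sum_nonneg hterm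
  refine ⟨by linarith, fun h0 => ?_⟩
  have h3 : (y - r y) ⬝ᵥ (C *ᵥ (y + r y)) = 0 := by linarith
  rw [dotProduct, Finset.sum_eq_zero_iff_of_nonneg hterm] at h3
  have h4 : r y ⬝ᵥ (C *ᵥ r y) = 0 := by linarith
  rw [← hqr, hry] at h4
  obtain ⟨d, hd⟩ := hco.prop _ h4
  refine ⟨j, d, ?_⟩
  ext i
  by_cases hi : i ∈ Set.range (circIndex j)
  · obtain ⟨k, rfl⟩ := hi
    rw [Pi.smul_apply, perturbedZero, (circIndex_injective hn j).extend_apply]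
    exact congrFun hd k
  · have h5 := (mul_eq_zero.mp (h3 i (Finset.mem_univ i))).resolve_right (hp i hi).ne'
    rw [Pi.sub_apply, hr0 i hi, sub_zero] at h5
    rw [h5, Pi.smul_apply, perturbedZero,
      Function.extend_apply' _ _ _ (fun ⟨k, hk⟩ => hi ⟨k, hk⟩)]
    simp

/-- Zero systems persist under perturbations that keep the determinants of all `A_{I_j}` zero. -/
lemma eventually (hn : 5 ≤ n) (h : IsCircZeroSystem A u) :
    ∀ᶠ C in 𝓝 A, C.IsSymm → (∀ j, (circSub C j).det = 0) →
      IsCircZeroSystem C (perturbedZero u C) := by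
  have hev := (isCompact_stdSimplex ℝ (Fin n)).eventually_forall_of_forall_eventually
    (x₀ := A) (P := fun C y => C.IsSymm → (∀ j, (circSub C j).det = 0) → (∀ i, 0 ≤ y i) →
      0 ≤ y ⬝ᵥ (C *ᵥ y) ∧ (y ⬝ᵥ (C *ᵥ y) = 0 →
        ∃ (j : Fin n) (c : ℝ), y = c • perturbedZero u C j)) (fun x hx => h.eventually_local hn hx)
  filter_upwards [hev, h.eventually_isCorankOne hn, h.eventually_subKernel_pos hn]
    with C hC hcor hpos hsymm hdet
  have hscale : ∀ x : Fin n → ℝ, (∀ i, 0 ≤ x i) → x ≠ 0 → 0 ≤ x ⬝ᵥ (C *ᵥ x) ∧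
      (x ⬝ᵥ (C *ᵥ x) = 0 → ∃ (j : Fin n) (c : ℝ), x = c • perturbedZero u C j) := by
    intro x hx hx0
    have hs : 0 < ∑ i, x i := by
      refine (Finset.sum_nonneg fun i _ => hx i).lt_of_ne fun h0 => hx0 ?_
      ext i
      exact (Finset.sum_eq_zero_iff_of_nonneg fun i _ => hx i).mp h0.symm i (Finset.mem_univ i)
    set s := ∑ i, x i with hsdef
    have hynn : ∀ i, 0 ≤ (s⁻¹ • x) i := fun i => by
      have := hx i
      simp only [Pi.smul_apply, smul_eq_mul]
      positivity
    have hy : s⁻¹ • x ∈ stdSimplex ℝ (Fin n) := by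
      refine ⟨hynn, ?_⟩
      simp only [Pi.smul_apply, smul_eq_mul]
      rw [← Finset.mul_sum, ← hsdef, inv_mul_cancel₀ hs.ne']
    obtain ⟨h1, h2⟩ := hC _ hy hsymm hdet hynn
    have e : (s⁻¹ • x) ⬝ᵥ (C *ᵥ (s⁻¹ • x)) = (s⁻¹) ^ 2 * (x ⬝ᵥ (C *ᵥ x)) := by
      simp only [Matrix.mulVec_smul, smul_dotProduct, dotProduct_smul, smul_eq_mul]
      ring
    rw [e] at h1 h2
    refine ⟨nonneg_of_mul_nonneg_right h1 (by positivity), fun h0 => ?_⟩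
    obtain ⟨j, c, hc⟩ := h2 (by rw [h0, mul_zero])
    refine ⟨j, s * c, ?_⟩
    rw [mul_smul, ← hc, smul_inv_smul₀ hs.ne']
  have hin : ∀ j k, perturbedZero u C j (circIndex j k) = subKernel u C j k := fun j k =>
    (circIndex_injective hn j).extend_apply _ _ _
  have hout : ∀ j i, i ∉ Set.range (circIndex j) → perturbedZero u C j i = 0 := fun j i hi =>
    Function.extend_apply' _ _ _ fun ⟨k, hk⟩ => hi ⟨k, hk⟩
  have hsupp : ∀ j, vecSupp (perturbedZero u C j) = Set.range (circIndex j) := by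
    intro j
    ext i
    by_cases hi : i ∈ Set.range (circIndex j)
    · obtain ⟨k, rfl⟩ := hi
      simp [vecSupp, hin, hpos]
    · simp [vecSupp, hout j i hi, hi]
  refine ⟨⟨hsymm, fun x hx => ?_⟩, fun j => ⟨fun h0 => ?_, fun i => ?_, ?_⟩, hsupp,
    fun v hv => (hscale v hv.2.1 hv.1).2 hv.2.2⟩
  · by_cases hx0 : x = 0
    · simp [hx0]
    · exact (hscale x hx hx0).1
  · have h1 := hin j ⟨0, by omega⟩
    rw [h0] at h1
    exact (hpos j ⟨0, by omega⟩).ne h1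
  · by_cases hi : i ∈ Set.range (circIndex j)
    · obtain ⟨k, rfl⟩ := hi
      rw [hin]; exact (hpos j k).le
    · rw [hout j i hi]
  · have e : perturbedZero u C j ∘ circIndex j = subKernel u C j := funext (hin j)
    rw [← quadForm_circSub hn C j (hout j), e, (hcor hsymm hdet j).ker, dotProduct_zero]

end IsCircZeroSystem

end Perturbation

/-! ### Regular zero sets of polynomials. -/

section Submanifolds

variable {E : Type*} [NormedAddCommGroup E] [NormedSpace ℝ E]

lemma IsPolynomialFunction.contDiff {f : E → ℝ} (hf : IsPolynomialFunction f)
    {m : WithTop ℕ∞} : ContDiff ℝ m f := by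
  obtain ⟨P, hP⟩ := hf
  rw [funext hP]
  clear hP
  induction P using MvPolynomial.induction_on with
  | C a => simpa using contDiff_const
  | add p q hp hq =>
    simp only [map_add]
    exact hp.add hq
  | mul_X p l hp =>
    simp only [map_mul, MvPolynomial.eval_X]
    exact hp.mul l.contDiff

lemma isPolynomialFunction_det {m : Type*} [Fintype m] [DecidableEq m] (M : E → Matrix m m ℝ)
    (hM : ∀ a b, ∃ l : E →L[ℝ] ℝ, ∀ x, M x a b = l x) :
    IsPolynomialFunction fun x => (M x).det := by
  choose l hl using hM
  refine ⟨(Matrix.of fun a b => MvPolynomial.X (l a b)).det, fun x => ?_⟩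
  simp only [RingHom.map_det]
  congr 1
  ext a b
  simp [hl]

/-- The regular zero set of a smooth map is a smooth submanifold. -/
lemma isSmoothSubmanifold_of_surjective [FiniteDimensional ℝ E] {k : ℕ} {F : E → Fin k → ℝ}
    (hF : ContDiff ℝ ((⊤ : ℕ∞) : WithTop ℕ∞) F) {U : Set E} (hU : IsOpen U)
    (hsurj : ∀ p ∈ U, F p = 0 → Function.Surjective (fderiv ℝ F p)) :
    IsSmoothSubmanifold k {x | x ∈ U ∧ F x = 0} := by
  have : CompleteSpace E := FiniteDimensional.complete ℝ E
  rintro p ⟨hpU, hp0⟩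
  set D := fderiv ℝ F p with hD
  have hDs : Function.Surjective D := hsurj p hpU hp0
  obtain ⟨R, hR⟩ := D.toLinearMap.exists_rightInverse_of_surjective
    (LinearMap.range_eq_top.mpr hDs)
  have hDR : ∀ y, D (R y) = y := fun y => LinearMap.congr_fun hR y
  set R' : (Fin k → ℝ) →L[ℝ] E := LinearMap.toContinuousLinearMap R with hR'
  -- Chosen so that `D ∘ g = F` while the derivative of `g` at `p` is the identity: `g` straightens
  -- the zero set to `ker D`.
  set g : E → E := fun x => x + R' (F x - D x) with hg
  have hgs : ContDiff ℝ ((⊤ : ℕ∞) : WithTop ℕ∞) g :=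
    contDiff_id.add (R'.contDiff.comp (hF.sub D.contDiff))
  have hne : ((⊤ : ℕ∞) : WithTop ℕ∞) ≠ 0 := by simp
  have hFd : HasFDerivAt F D p := (hF.differentiable hne p).hasFDerivAt
  have hgd : HasFDerivAt g ((ContinuousLinearEquiv.refl ℝ E : E ≃L[ℝ] E) : E →L[ℝ] E) p := by
    have h1 := (hasFDerivAt_id p).add (R'.hasFDerivAt.comp p (hFd.sub D.hasFDerivAt))
    have e : ContinuousLinearMap.id ℝ E + R' ∘SL (D - D) =
        ((ContinuousLinearEquiv.refl ℝ E : E ≃L[ℝ] E) : E →L[ℝ] E) := by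
      rw [sub_self, ContinuousLinearMap.comp_zero, add_zero]
      rfl
    rw [e] at h1
    exact h1
  set e := hgs.contDiffAt.toOpenPartialHomeomorph g hgd hne with he
  have hpe : p ∈ e.source := hgs.contDiffAt.mem_toOpenPartialHomeomorph_source hgd hne
  -- Keeping only points with invertible derivative makes the inverse smooth on the whole target,
  -- not just near `g p`.
  set S : Set E := U ∩ {x | IsUnit (fderiv ℝ g x)} with hS
  have hSo : IsOpen S :=
    hU.inter (Units.isOpen.preimage (hgs.continuous_fderiv hne))
  have hpS : p ∈ S := by
    refine ⟨hpU, ?_⟩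
    change IsUnit (fderiv ℝ g p)
    rw [hgd.fderiv]
    exact isUnit_one
  refine ⟨e.restrOpen S hSo, LinearMap.ker D.toLinearMap, ⟨hpe, hpS⟩, hgs.contDiffOn, ?_, ?_, ?_⟩
  · intro y hy
    refine ContDiffAt.contDiffWithinAt ?_
    have hys := (e.restrOpen S hSo).map_target hy
    obtain ⟨v, hv⟩ := hys.2.2
    refine (e.restrOpen S hSo).contDiffAt_symm
      (f₀' := ContinuousLinearEquiv.ofUnit v) hy ?_ hgs.contDiffAt
    have h1 := (hgs.differentiable hne ((e.restrOpen S hSo).symm y)).hasFDerivAt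
    have h2 : ((ContinuousLinearEquiv.ofUnit v : E ≃L[ℝ] E) : E →L[ℝ] E) =
      fderiv ℝ g ((e.restrOpen S hSo).symm y) := hv
    rw [h2]
    exact h1
  · have h1 := LinearMap.finrank_range_add_finrank_ker D.toLinearMap
    rw [LinearMap.range_eq_top.mpr hDs, finrank_top, Module.finrank_fin_fun] at h1
    omega
  · rintro x ⟨-, hxU, -⟩
    have h1 : D (g x) = F x := by
      simp only [hg, map_add, hR', LinearMap.coe_toContinuousLinearMap', hDR]
      abel
    change (x ∈ U ∧ F x = 0) ↔ D (g x) = 0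
    rw [h1]
    exact ⟨fun h => h.2, fun h => ⟨hxU, h⟩⟩

/-- A zero set of `k` polynomials in an open set on which they have a dual family of directions
is an algebraic submanifold. -/
lemma isAlgebraicSubmanifold_of_directions [FiniteDimensional ℝ E] {k : ℕ} {f : Fin k → E → ℝ}
    (hf : ∀ i, IsPolynomialFunction (f i)) {U : Set E} (hU : IsOpen U)
    (hdir : ∀ p ∈ U, (∀ i, f i p = 0) → ∀ j, ∃ v : E, fderiv ℝ (f j) p v ≠ 0 ∧
      ∀ i, i ≠ j → fderiv ℝ (f i) p v = 0) :
    IsAlgebraicSubmanifold k {x | x ∈ U ∧ ∀ i, f i x = 0} := by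
  refine ⟨?_, ⟨U, k, f, hU, hf, rfl⟩, ?_⟩
  · have hset : {x | x ∈ U ∧ ∀ i, f i x = 0} = {x | x ∈ U ∧ (fun x i => f i x) x = 0} := by
      ext x
      simp [funext_iff]
    rw [hset]
    refine isSmoothSubmanifold_of_surjective (contDiff_pi.mpr fun i => (hf i).contDiff) hU ?_
    intro p hp h0 y
    choose v hv hv0 using hdir p hp (congrFun h0)
    refine ⟨∑ j, (y j / fderiv ℝ (f j) p (v j)) • v j, ?_⟩
    have hd : ∀ i, DifferentiableAt ℝ (f i) p := fun i =>
      (hf i).contDiff.differentiable (n := 1) one_ne_zero p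
    ext i
    have e : fderiv ℝ (fun x i => f i x) p = ContinuousLinearMap.pi fun i => fderiv ℝ (f i) p :=
      fderiv_pi hd
    rw [e, ContinuousLinearMap.pi_apply, map_sum, Finset.sum_eq_single i]
    · rw [map_smul, smul_eq_mul, div_mul_cancel₀ _ (hv i)]
    · intro j _ hji
      rw [map_smul, hv0 j i hji.symm, smul_zero]
    · simp
  · rintro p ⟨hp, h0⟩
    refine ⟨U, f, hU, hp, hf, fun x hx => ⟨fun h => h.2, fun h => ⟨hx, h⟩⟩, ?_⟩
    rw [Fintype.linearIndependent_iff]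
    intro g hg j
    obtain ⟨v, hv, hv0⟩ := hdir p hp h0 j
    have h1 := congrArg (fun l : E →L[ℝ] ℝ => l v) hg
    simp only [sum_apply, smul_apply, smul_eq_mul, zero_apply] at h1
    rw [Finset.sum_eq_single j (fun i _ hij => by rw [hv0 i hij, mul_zero]) (by simp)] at h1
    exact (mul_eq_zero.mp h1).resolve_right hv

end Submanifolds

/-! ### Differentials of the determinants, and the theorem. -/

section DeterminantLocus

variable {n : ℕ}

lemma isPolynomialFunction_det_circSub (j : Fin n) :
    IsPolynomialFunction fun A : symMat n =>
      (circSub (A : Matrix (Fin n) (Fin n) ℝ) j).det :=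
  isPolynomialFunction_det _ fun a b => ⟨LinearMap.toContinuousLinearMap
    ((Matrix.entryLinearMap ℝ ℝ (circIndex j a) (circIndex j b)).comp (symMat n).subtype),
    fun _ => rfl⟩

lemma IsCircZeroSystem.exists_fderiv_det (hn : 5 ≤ n) {A : symMat n} {u : Fin n → Fin n → ℝ}
    (h : IsCircZeroSystem (A : Matrix (Fin n) (Fin n) ℝ) u) (j : Fin n) :
    ∃ H : symMat n,
      fderiv ℝ (fun A : symMat n => (circSub (A : Matrix (Fin n) (Fin n) ℝ) j).det) A H ≠ 0 ∧
      ∀ i, i ≠ j →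
        fderiv ℝ (fun A : symMat n => (circSub (A : Matrix (Fin n) (Fin n) ℝ) i).det) A H = 0 := by
  obtain ⟨H, hH, hne, h0⟩ := h.exists_direction hn j
  have key : ∀ i, ∃ c : ℝ, 0 < c ∧
      fderiv ℝ (fun A : symMat n => (circSub (A : Matrix (Fin n) (Fin n) ℝ) i).det) A ⟨H, hH⟩ =
        c * (u i ⬝ᵥ (H *ᵥ u i)) := by
    intro i
    obtain ⟨c, hc, hder⟩ := (h.isCorankOne hn i).hasDerivAt_det
    refine ⟨c, hc, ?_⟩
    have h1 := hder (circSub H i)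
    rw [quadForm_circSub hn H i fun k hk => h.eq_zero hk] at h1
    have hd : DifferentiableAt ℝ
        (fun A : symMat n => (circSub (A : Matrix (Fin n) (Fin n) ℝ) i).det) A :=
      (isPolynomialFunction_det_circSub i).contDiff.differentiable (n := 1) one_ne_zero A
    have h2 := hd.hasFDerivAt.hasLineDerivAt (⟨H, hH⟩ : symMat n)
    exact h2.unique h1
  refine ⟨⟨H, hH⟩, ?_, fun i hi => ?_⟩
  · obtain ⟨c, hc, he⟩ := key j
    rw [he]
    exact mul_ne_zero hc.ne' hne
  · obtain ⟨c, hc, he⟩ := key i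
    rw [he, h0 i hi, mul_zero]

end DeterminantLocus

theorem mainTheorem5 (n : ℕ) (hn : 5 ≤ n) (Ahat : symMat n)
    (hA : HasMinimalCirculantZeroSupport (Ahat : Matrix (Fin n) (Fin n) ℝ)) :
    ∃ U : Set (symMat n), IsOpen U ∧ Ahat ∈ U ∧
      (∀ A ∈ U, (∀ j : Fin n, (circSub (A : Matrix (Fin n) (Fin n) ℝ) j).det = 0) →
        IsExceptional (A : Matrix (Fin n) (Fin n) ℝ) ∧
        HasMinimalCirculantZeroSupport (A : Matrix (Fin n) (Fin n) ℝ)) ∧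
      IsAlgebraicSubmanifold n
        {A : symMat n | A ∈ U ∧
          ∀ j : Fin n, (circSub (A : Matrix (Fin n) (Fin n) ℝ) j).det = 0} := by
  obtain ⟨hex, u, hu, hprop⟩ := hA
  have h : IsCircZeroSystem (Ahat : Matrix (Fin n) (Fin n) ℝ) u :=
    ⟨hex.1, fun j => (hu j).1, fun j => (hu j).2, hprop⟩
  have hval : Filter.Tendsto (fun A : symMat n => (A : Matrix (Fin n) (Fin n) ℝ)) (𝓝 Ahat)
      (𝓝 (Ahat : Matrix (Fin n) (Fin n) ℝ)) := continuous_subtype_val.tendsto _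
  obtain ⟨U, hU, hUo, hmem⟩ := eventually_nhds_iff.mp (hval.eventually (h.eventually hn))
  refine ⟨U, hUo, hmem, fun A hAU hdet => ?_, ?_⟩
  · have h1 := hU A hAU A.2 hdet
    exact ⟨h1.isExceptional hn, h1.hasMinimalCirculantZeroSupport hn⟩
  -- Every point of the locus in `U` carries its own zero system, so independence is obtained there
  -- directly.
  · exact isAlgebraicSubmanifold_of_directions isPolynomialFunction_det_circSub hUo
      fun A hAU hdet j => (hU A hAU A.2 hdet).exists_fderiv_det hn j
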